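/- Let $\gamma_1$ be the standard Gaussian measure on $\mathbb{R}$. For a probability measure $m$ on $\mathbb{R}$ with finite second moment and a Borel set $A\subset\mathbb{R}$ with $m(A)>0$, put $\mu_{m,A}:=m(A)^{-1}m|_A$, $\operatorname{bar}(m):=\int x\,dm(x)$ and $\operatorname{bar}_m(A):=\operatorname{bar}(\mu_{m,A})=m(A)^{-1}\int_A x\,dm(x)$. For $A,B\subset\mathbb{R}$ let $d(A,B):=\inf\{|a-b| : a\in A,\ b\in B\}$. An optimal transport map from $\mu$ to $\nu$ is a nondecreasing map $T:\mathbb{R}\to\mathbb{R}$ (i.e. a gradient of a convex function) with $T_\#\mu=\nu$ and $\int (T(x)-x)^2\,d\mu(x)=W_2^2(\mu,\nu)$, where $W_2^2(\mu,\nu)=\inf_\pi\int |x-y|^2\,d\pi(x,y)$ over all couplings $\pi$ of $\mu$ and $\nu$; it is unique $\mu$-a.e., and below any such version may be taken. **Theorem 6.1.** (1) Let $\kappa>0$ and let $m=e^{-V}\mathcal{L}^1$ be a probability measure on $\mathbb{R}$ ($\mathcal L^1$ being Lebesgue measure), where $V\in C^\infty(\mathbb{R})$ is $\kappa$-convex,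 i.e. $V((1-t)x+ty)\le(1-t)V(x)+tV(y)-\frac{\kappa}{2}t(1-t)|x-y|^2$ for all $x,y\in\mathbb{R}$, $t\in[0,1]$, and $V(0)=\min V$. Let $A,B\subset\mathbb{R}$ be Borel sets with $m(A),m(B)>0$. Then optimal transport maps from $m$ to $\mu_{m,A}$ and from $m$ to $\mu_{m,B}$ exist. For all such maps $S$ (to $\mu_{m,A}$) and $T$ (to $\mu_{m,B}$), setting $\alpha_{m,A}:=S(0)$, $\alpha_{m,B}:=T(0)$ and $$\Phi(m,A,B):=-\alpha_{m,B}\operatorname{bar}_m(A)-\alpha_{m,A}\operatorname{bar}_m(B)+\alpha_{m,A}\alpha_{m,B}+(\alpha_{m,A}+\alpha_{m,B})\operatorname{bar}(m),$$ we have $$m(A)m(B)\le\exp\Bigl(-\frac{\kappa}{2}d(A,B)^2+\kappa\,\Phi(m,A,B)\Bigr).$$ (2) Let $A,B\subset\mathbb{R}$ be Borel sets with $\gamma_1(A),\gamma_1(B)>0$. Then the maps in (1) exist for $m=\gamma_1$, and for all of them, with $\alpha_{\gamma_1,A},\alpha_{\gamma_1,B}$ defined as in (1), $\Phi(A,B):=\Phi(\gamma_1,A,B)=-\alpha_{\gamma_1,B}\operatorname{bar}_{\gamma_1}(A)-\alpha_{\gamma_1,A}\operatorname{bar}_{\gamma_1}(B)+\alpha_{\gamma_1,A}\alpha_{\gamma_1,B}$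 and $$\gamma_1(A)\gamma_1(B)\le\exp\Bigl(-\frac12 d(A,B)^2+\min\bigl\{\Phi(A,B),\,-\operatorname{bar}_{\gamma_1}(A)\operatorname{bar}_{\gamma_1}(B)\bigr\}\Bigr).$$ -/

import Mathlib

open MeasureTheory ProbabilityTheory Set
open scoped ENNReal ContDiff

namespace Conc

noncomputable section

/-- `π` is a coupling of `μ` and `ν`. -/
def IsCoupling (π : Measure (ℝ × ℝ)) (μ ν : Measure ℝ) : Prop :=
  π.map Prod.fst = μ ∧ π.map Prod.snd = ν

/-- The `L²`-Wasserstein distance on the real line (with values in `[0, ∞]`). -/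
def W₂ (μ ν : Measure ℝ) : ℝ≥0∞ :=
  (⨅ π ∈ {π : Measure (ℝ × ℝ) | IsCoupling π μ ν},
    ∫⁻ p, ENNReal.ofReal ((p.1 - p.2) ^ 2) ∂π) ^ (1 / 2 : ℝ)

/-- `T` is an optimal transport map from `μ` to `ν`: it pushes `μ` to `ν`, its quadratic cost is
`W₂ μ ν ^ 2`, and it is a gradient of a convex function, which on the line means that it is
nondecreasing. The first two conditions determine `T` only up to `μ`-null sets; monotonicity
selects the versions whose values at single points are meaningful (at a jump of the map, any
value between the one-sided limits is allowed). -/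
structure IsOptimalTransportMap (μ ν : Measure ℝ) (T : ℝ → ℝ) : Prop where
  monotone : Monotone T
  map_eq : μ.map T = ν
  cost_eq : ∫⁻ x, ENNReal.ofReal ((T x - x) ^ 2) ∂μ = W₂ μ ν ^ 2

/-- The barycenter of a probability measure on the line. -/
def bary (μ : Measure ℝ) : ℝ := ∫ x, x ∂μ

/-- The barycenter of the normalized restriction of `m` to `A`. -/
def baryOn (m : Measure ℝ) (A : Set ℝ) : ℝ := bary (cond m A)

/-- The distance `inf {|a - b| : a ∈ A, b ∈ B}` between two sets. -/
def setDist (A B : Set ℝ) : ℝ := sInf {r : ℝ | ∃ a ∈ A, ∃ b ∈ B, r = |a - b|}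

/-- The correction term, where `α` and `β` stand for the values, at the mode of `m`, of the
optimal transport maps from `m` to its normalized restrictions to `A` and to `B`. -/
def Phi (m : Measure ℝ) (A B : Set ℝ) (α β : ℝ) : ℝ :=
  -β * baryOn m A - α * baryOn m B + α * β + (α + β) * bary m

end

end Conc

/-!
For a monotone transport map `S` from `m = exp (-V)` to `m` conditioned on `A`, the distribution
functions are conjugate, so at almost every `x` the Monge–Ampère equation
`S' exp (-V ∘ S) = m(A) exp (-V)` holds (`ae_hasDerivAt_of_map`), and similarly for `T` and `B`.
Taking logarithms, the constant `-log (m(A) m(B))` equals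
`V ∘ S + V ∘ T - 2 V - log (S' T')` almost everywhere.

Let `α = S x₀` and `β = T x₀`, where `V' x - κ x` has the sign of `x - x₀`, and let `h` be the
geometric mean `±√((S - α) (T - β))`, a monotone function (`exists_geomMean`) with `h' ≥ √(S' T')`
(`mul_le_sq_of_hasDerivAt`). The tangent inequality for the `κ`-convex `V`, the inequality between
arithmetic and geometric means and `log r ≤ r - 1` give, with `q x = h x - x + (α + β) / 2`,
`κ / 2 (S - T)² + κ (β S + α T - α β - (α + β) x) + 2 (V' q - q') ≤ -log (m(A) m(B))`
(`pointwise_le`). Integrate against `m`. The first term is at least `κ / 2 d(A, B)²`, the second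
integrates to `-κ Φ`, and the third contributes a nonnegative amount, because
`∫ q' exp (-V) ≤ ∫ V' q exp (-V)`: jumps of `h` can only help. The last fact is used in its
truncated form on `[-R, R]`, where the derivative of `G = q exp (-V)` integrates to at most the
increment of `G` (`intervalIntegral_deriv_le`); the boundary terms are integrable in `R` and
therefore cannot obstruct the limit (`nonneg_of_tendsto_of_integrable`). No integrability of `V'`
is needed. This is `real_mul_real_le_exp`.

For a potential with minimum at `0` one takes `x₀ = 0`. For the Gaussian measure `V' x - κ x = 0`,
so that every `x₀` is allowed. At a point where `S` crosses its mean, one may redefine `S` to take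
the mean as its value; then `Φ` becomes minus the product of the barycenters, which gives the
second bound.

Transport maps exist by composing the distribution function of the source with the quantile
function of the target (`exists_isOptimalTransportMap`). Their optimality
(`lintegral_le_of_monotone`) follows by writing `(x - y)²` as an area: the cost of a plan is an
integral of the masses of quadrants, and a monotone coupling minimizes each of them.
-/

namespace Conc

/-! ### Monotone transport on the line is optimal -/

lemma ofReal_sub_sq (a b : ℝ) :
    ENNReal.ofReal ((a - b) ^ 2) =
      volume (Ico a b ×ˢ Ico a b) + volume (Ico b a ×ˢ Ico b a) := by
  simp only [Measure.volume_eq_prod, Measure.prod_prod, Real.volume_Ico]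
  rcases le_total a b with h | h
  · rw [ENNReal.ofReal_of_nonpos (sub_nonpos.2 h), ← ENNReal.ofReal_mul (sub_nonneg.2 h)]
    simp only [mul_zero, add_zero]
    ring_nf
  · rw [ENNReal.ofReal_of_nonpos (sub_nonpos.2 h), ← ENNReal.ofReal_mul (sub_nonneg.2 h)]
    simp only [mul_zero, zero_add]
    ring_nf

/-- The quadratic cost of a plan is determined by the masses it gives to the quadrants
`{x ≤ c, d < y}` and `{y ≤ c, d < x}` with `c ≤ d`. -/
lemma lintegral_sub_sq (π : Measure (ℝ × ℝ)) [SFinite π] :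
    ∫⁻ p, ENNReal.ofReal ((p.1 - p.2) ^ 2) ∂π =
      ∫⁻ s : ℝ × ℝ, π ((Prod.fst ⁻¹' Iic (min s.1 s.2)) \ (Prod.snd ⁻¹' Iic (max s.1 s.2))) +
        π ((Prod.snd ⁻¹' Iic (min s.1 s.2)) \ (Prod.fst ⁻¹' Iic (max s.1 s.2))) := by
  have key : ∀ f g : ℝ × ℝ → ℝ, Measurable f → Measurable g →
      ∫⁻ p, volume (Ico (f p) (g p) ×ˢ Ico (f p) (g p)) ∂π =
        ∫⁻ s : ℝ × ℝ, π ((f ⁻¹' Iic (min s.1 s.2)) \ (g ⁻¹' Iic (max s.1 s.2))) ∧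
      (Measurable fun p => volume (Ico (f p) (g p) ×ˢ Ico (f p) (g p))) ∧
      Measurable fun s : ℝ × ℝ => π ((f ⁻¹' Iic (min s.1 s.2)) \ (g ⁻¹' Iic (max s.1 s.2))) := by
    intro f g hf hg
    let E : Set ((ℝ × ℝ) × (ℝ × ℝ)) := {q | f q.1 ≤ min q.2.1 q.2.2} ∩ {q | max q.2.1 q.2.2 < g q.1}
    have hE : MeasurableSet E :=
      (measurableSet_le (by fun_prop) (by fun_prop)).inter
        (measurableSet_lt (by fun_prop) (by fun_prop))
    have h1 : ∀ p, Ico (f p) (g p) ×ˢ Ico (f p) (g p) = Prod.mk p ⁻¹' E := by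
      intro p; ext s
      simp only [E, mem_prod, mem_Ico, mem_preimage, mem_inter_iff, mem_ofPred_eq, le_min_iff,
        max_lt_iff]
      tauto
    have h2 : ∀ s : ℝ × ℝ, (f ⁻¹' Iic (min s.1 s.2)) \ (g ⁻¹' Iic (max s.1 s.2)) =
        (fun p => (p, s)) ⁻¹' E := by
      intro s; ext p
      simp only [E, mem_sdiff, mem_preimage, mem_Iic, mem_inter_iff, mem_ofPred_eq, not_le]
    simp only [h1, h2]
    exact ⟨(Measure.prod_apply hE).symm.trans (Measure.prod_apply_symm hE),
      measurable_measure_prodMk_left hE, measurable_measure_prodMk_right hE⟩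
  obtain ⟨e1, m1, n1⟩ := key Prod.fst Prod.snd measurable_fst measurable_snd
  obtain ⟨e2, m2, n2⟩ := key Prod.snd Prod.fst measurable_snd measurable_fst
  simp only [ofReal_sub_sq]
  rw [lintegral_add_left m1, lintegral_add_left n1, e1, e2]

/-- Nested sets minimize the mass of their difference. -/
lemma measure_diff_le_of_isLowerSet {μ : Measure ℝ} [IsFiniteMeasure μ] {C D : Set ℝ}
    (hC : IsLowerSet C) (hD : IsLowerSet D) (hDm : MeasurableSet D) :
    μ (C \ D) ≤ μ C - μ D := by
  rcases hC.total hD with h | h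
  · simp [sdiff_eq_empty.2 h]
  · exact (measure_sdiff h hDm.nullMeasurableSet (measure_ne_top _ _)).le

/-- A nondecreasing map has the least quadratic cost among all couplings of its marginals. -/
lemma lintegral_le_of_monotone {μ ν : Measure ℝ} [IsFiniteMeasure μ] {S : ℝ → ℝ}
    (hS : Monotone S) (hmap : μ.map S = ν) {π : Measure (ℝ × ℝ)} (hπ : IsCoupling π μ ν) :
    ∫⁻ x, ENNReal.ofReal ((S x - x) ^ 2) ∂μ ≤ ∫⁻ p, ENNReal.ofReal ((p.1 - p.2) ^ 2) ∂π := by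
  have hSm := hS.measurable
  obtain ⟨h1, h2⟩ := hπ
  have : IsFiniteMeasure π := by
    constructor
    have := measure_lt_top μ univ
    rwa [← h1, Measure.map_apply measurable_fst .univ] at this
  have hpair : Measurable fun x => (x, S x) := by fun_prop
  have h0 : ∫⁻ x, ENNReal.ofReal ((S x - x) ^ 2) ∂μ =
      ∫⁻ p, ENNReal.ofReal ((p.1 - p.2) ^ 2) ∂(μ.map fun x => (x, S x)) := by
    rw [lintegral_map (by fun_prop) hpair]
    simp only [← neg_sub (S _), neg_sq]
  have e1 : ∀ c, π (Prod.fst ⁻¹' Iic c) = μ (Iic c) := fun c => by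
    rw [← h1, Measure.map_apply measurable_fst measurableSet_Iic]
  have e2 : ∀ c, π (Prod.snd ⁻¹' Iic c) = μ (S ⁻¹' Iic c) := fun c => by
    rw [← Measure.map_apply hSm measurableSet_Iic, hmap, ← h2,
      Measure.map_apply measurable_snd measurableSet_Iic]
  have l2 : ∀ c, IsLowerSet (S ⁻¹' Iic c) := fun c a b hba ha => (hS hba).trans ha
  rw [h0, lintegral_sub_sq, lintegral_sub_sq]
  refine lintegral_mono fun s => add_le_add ?_ ?_
  · rw [Measure.map_apply hpair (by measurability)]
    refine (measure_diff_le_of_isLowerSet (isLowerSet_Iic _) (l2 _)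
      (hSm measurableSet_Iic)).trans ?_
    rw [← e1, ← e2]
    exact le_measure_sdiff
  · rw [Measure.map_apply hpair (by measurability)]
    refine (measure_diff_le_of_isLowerSet (l2 _) (isLowerSet_Iic _) measurableSet_Iic).trans ?_
    rw [← e1, ← e2]
    exact le_measure_sdiff

lemma W₂_sq (μ ν : Measure ℝ) :
    W₂ μ ν ^ 2 = ⨅ π ∈ {π : Measure (ℝ × ℝ) | IsCoupling π μ ν},
      ∫⁻ p, ENNReal.ofReal ((p.1 - p.2) ^ 2) ∂π := by
  rw [W₂, ← ENNReal.rpow_natCast, ← ENNReal.rpow_mul]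
  norm_num

lemma isOptimalTransportMap_of_monotone {μ ν : Measure ℝ} [IsFiniteMeasure μ] {S : ℝ → ℝ}
    (hS : Monotone S) (hmap : μ.map S = ν) : IsOptimalTransportMap μ ν S := by
  refine ⟨hS, hmap, ?_⟩
  have hSm := hS.measurable
  rw [W₂_sq]
  refine le_antisymm (le_iInf₂ fun π hπ => lintegral_le_of_monotone hS hmap hπ) ?_
  have hpair : Measurable fun x => (x, S x) := by fun_prop
  have hcoup : IsCoupling (μ.map fun x => (x, S x)) μ ν := by
    refine ⟨?_, ?_⟩
    · rw [Measure.map_map measurable_fst hpair]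
      exact Measure.map_id
    · rw [Measure.map_map measurable_snd hpair]
      exact hmap
  refine (iInf₂_le (μ.map fun x => (x, S x)) hcoup).trans_eq ?_
  rw [lintegral_map (by fun_prop) hpair]
  simp only [← neg_sub (S _), neg_sq]

/-! ### The quantile transform -/

lemma continuous_cdf (μ : Measure ℝ) [IsProbabilityMeasure μ] [NullSingletonClass μ] :
    Continuous (cdf μ) := by
  refine continuous_iff_continuousAt.2 fun x => ?_
  rw [(monotone_cdf μ).continuousAt_iff_leftLim_eq_rightLim, StieltjesFunction.rightLim_eq]
  have h : (cdf μ).measure {x} = 0 := by rw [measure_cdf]; exact measure_singleton x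
  rw [StieltjesFunction.measure_singleton, ENNReal.ofReal_eq_zero] at h
  exact le_antisymm ((monotone_cdf μ).leftLim_le le_rfl) (by linarith)

lemma measure_Iic_strictMono (μ : Measure ℝ) [IsFiniteMeasure μ] [μ.IsOpenPosMeasure] :
    StrictMono fun x => μ (Iic x) := by
  intro x y hxy
  have hsub : μ (Iic x) + μ (Ioo x y) ≤ μ (Iic y) := by
    have hdisj : Disjoint (Iic x) (Ioo x y) :=
      Set.disjoint_left.2 fun z (hz : z ≤ x) hz' => hz'.1.not_ge hz
    rw [← measure_union hdisj measurableSet_Ioo]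
    exact measure_mono (union_subset (Iic_subset_Iic.2 hxy.le) fun z hz => hz.2.le)
  exact (ENNReal.lt_add_right (measure_ne_top μ _) ((Measure.measure_Ioo_pos μ).2 hxy).ne').trans_le
    hsub

lemma cdf_pos (μ : Measure ℝ) [IsProbabilityMeasure μ] [μ.IsOpenPosMeasure] (x : ℝ) :
    0 < cdf μ x := by
  rw [cdf_eq_real]
  exact ENNReal.toReal_pos ((Measure.measure_Iio_pos μ x).trans_le
    (measure_mono Iio_subset_Iic_self)).ne' (measure_ne_top _ _)

/-- The cumulative distribution function of a diffuse measure with full support maps that measure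
to the uniform distribution on `(0, 1)`. -/
lemma measure_cdf_le (μ : Measure ℝ) [IsProbabilityMeasure μ] [NullSingletonClass μ]
    [μ.IsOpenPosMeasure] {u : ℝ} (h0 : 0 ≤ u) (h1 : u ≤ 1) :
    μ {x | cdf μ x ≤ u} = ENNReal.ofReal u := by
  rcases h0.eq_or_lt with rfl | h0
  · have : {x | cdf μ x ≤ 0} = ∅ := by
      ext x; simpa using cdf_pos μ x
    simp [this]
  rcases h1.eq_or_lt with rfl | h1
  · have : {x | cdf μ x ≤ 1} = univ := by
      ext x; simpa using cdf_le_one μ x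
    simp [this]
  obtain ⟨a, ha⟩ := ((tendsto_cdf_atBot μ).eventually (gt_mem_nhds h0)).exists
  obtain ⟨b, hb⟩ := ((tendsto_cdf_atTop μ).eventually (lt_mem_nhds h1)).exists
  obtain ⟨x, hx⟩ := mem_range_of_exists_le_of_exists_ge (continuous_cdf μ) ⟨a, ha.le⟩ ⟨b, hb.le⟩
  have hset : {y | cdf μ y ≤ u} = Iic x := by
    ext y
    simp only [mem_ofPred_eq, mem_Iic]
    refine ⟨fun hy => ?_, fun hy => hx ▸ monotone_cdf μ hy⟩
    by_contra! hlt
    refine (measure_Iic_strictMono μ hlt).not_ge ?_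
    dsimp only
    rw [← ofReal_cdf, ← ofReal_cdf, hx]
    exact ENNReal.ofReal_le_ofReal hy
  rw [hset, ← ofReal_cdf, hx]

/-- The quantile function of `ν` composed with the distribution function of `μ` transports `μ`
to `ν`. -/
lemma exists_isOptimalTransportMap (μ ν : Measure ℝ) [IsProbabilityMeasure μ]
    [NullSingletonClass μ] [μ.IsOpenPosMeasure] [IsProbabilityMeasure ν] :
    ∃ S, IsOptimalTransportMap μ ν S := by
  have hlt : ∀ x, cdf μ x < 1 := fun x => by
    by_contra! h
    have h1 : μ (Iic x) = 1 := by
      rw [← ofReal_cdf, le_antisymm (cdf_le_one μ x) h, ENNReal.ofReal_one]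
    have h2 := (prob_compl_eq_zero_iff (measurableSet_Iic (a := x))).2 h1
    rw [compl_Iic] at h2
    exact (Measure.measure_Ioi_pos μ x).ne' h2
  let Q : ℝ → Set ℝ := fun x => {y | cdf μ x ≤ cdf ν y}
  have hbdd : ∀ x, BddBelow (Q x) := fun x => by
    obtain ⟨a, ha⟩ := ((tendsto_cdf_atBot ν).eventually (gt_mem_nhds (cdf_pos μ x))).exists
    refine ⟨a, fun y hy => le_of_not_ge fun hya => ?_⟩
    exact (ha.trans_le hy).not_ge (monotone_cdf ν hya)
  have hne : ∀ x, (Q x).Nonempty := fun x => by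
    obtain ⟨b, hb⟩ := ((tendsto_cdf_atTop ν).eventually (lt_mem_nhds (hlt x))).exists
    exact ⟨b, hb.le⟩
  let S : ℝ → ℝ := fun x => sInf (Q x)
  have hgal : ∀ x y, S x ≤ y ↔ cdf μ x ≤ cdf ν y := fun x y => by
    refine ⟨fun h => ?_, fun h => csInf_le (hbdd x) h⟩
    have hright : ∀ z, y < z → cdf μ x ≤ cdf ν z := fun z hz => by
      obtain ⟨w, hw, hwz⟩ := exists_lt_of_csInf_lt (hne x) (h.trans_lt hz)
      exact le_trans hw (monotone_cdf ν hwz.le)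
    refine ge_of_tendsto (((cdf ν).right_continuous y).mono Ioi_subset_Ici_self) ?_
    filter_upwards [self_mem_nhdsWithin] with z hz using hright z hz
  have hS : Monotone S := fun x x' h =>
    (hgal x _).2 ((monotone_cdf μ h).trans ((hgal x' _).1 le_rfl))
  refine ⟨S, isOptimalTransportMap_of_monotone hS ?_⟩
  have : IsProbabilityMeasure (μ.map S) :=
    Measure.isProbabilityMeasure_map hS.measurable.aemeasurable
  refine Measure.ext_of_Iic _ _ fun y => ?_
  rw [Measure.map_apply hS.measurable measurableSet_Iic]
  have : S ⁻¹' Iic y = {x | cdf μ x ≤ cdf ν y} := by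
    ext x; exact hgal x y
  rw [this, measure_cdf_le μ (cdf_nonneg ν y) (cdf_le_one ν y), ofReal_cdf]

/-! ### Probability measures with density `exp (-V)` -/

section Density

variable {V : ℝ → ℝ} {m : Measure ℝ}

lemma real_eq_setIntegral (hV : Continuous V)
    (hm : m = volume.withDensity (fun x => ENNReal.ofReal (Real.exp (-V x)))) {B : Set ℝ}
    (hB : MeasurableSet B) : m.real B = ∫ t in B, Real.exp (-V t) := by
  rw [measureReal_def, hm, withDensity_apply _ hB,
    integral_eq_lintegral_of_nonneg_ae (.of_forall fun x => (Real.exp_pos _).le)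
      (by fun_prop : Continuous fun t => Real.exp (-V t)).aestronglyMeasurable]

lemma integrable_iff_mul_exp (hV : Continuous V)
    (hm : m = volume.withDensity (fun x => ENNReal.ofReal (Real.exp (-V x)))) (f : ℝ → ℝ) :
    Integrable f m ↔ Integrable fun x => f x * Real.exp (-V x) := by
  rw [hm, integrable_withDensity_iff_integrable_smul'
    (by fun_prop) (.of_forall fun x => ENNReal.ofReal_lt_top)]
  simp only [ENNReal.toReal_ofReal (Real.exp_pos _).le, smul_eq_mul, mul_comm]

lemma integral_eq_mul_exp (hV : Continuous V)
    (hm : m = volume.withDensity (fun x => ENNReal.ofReal (Real.exp (-V x)))) (f : ℝ → ℝ) :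
    ∫ x, f x ∂m = ∫ x, f x * Real.exp (-V x) := by
  rw [hm, integral_withDensity_eq_integral_toReal_smul
    (by fun_prop) (.of_forall fun x => ENNReal.ofReal_lt_top)]
  simp only [ENNReal.toReal_ofReal (Real.exp_pos _).le, smul_eq_mul, mul_comm]

lemma volume_absolutelyContinuous (hV : Continuous V)
    (hm : m = volume.withDensity (fun x => ENNReal.ofReal (Real.exp (-V x)))) : volume ≪ m := by
  rw [hm]
  refine withDensity_absolutelyContinuous' (by fun_prop) (.of_forall fun x => ?_)
  simpa using Real.exp_pos _

lemma absolutelyContinuous_volume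
    (hm : m = volume.withDensity (fun x => ENNReal.ofReal (Real.exp (-V x)))) : m ≪ volume := by
  rw [hm]
  exact withDensity_absolutelyContinuous _ _

end Density

lemma ae_hasDerivAt_setIntegral_Iic {g : ℝ → ℝ} (hg : Integrable g) :
    ∀ᵐ y, HasDerivAt (fun y => ∫ t in Iic y, g t) (g y) y := by
  filter_upwards [LocallyIntegrable.ae_hasDerivAt_integral hg.locallyIntegrable] with y hy
  have : (fun y => ∫ t in Iic y, g t) = fun y => (∫ t in Iic 0, g t) + ∫ t in (0 : ℝ)..y, g t := by
    ext z
    rw [← intervalIntegral.integral_Iic_sub_Iic hg.integrableOn hg.integrableOn]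
    ring
  rw [this]
  exact (hy 0).const_add _

/-! ### The Monge–Ampère equation on the line -/

section MongeAmpere

variable {m ν : Measure ℝ} {S : ℝ → ℝ}

/-- If the target has no atoms, the flat parts of a monotone transport map are negligible, and
the map conjugates the distribution functions. -/
lemma measure_Iic_map (hS : Monotone S) (hmap : m.map S = ν) [NullSingletonClass ν] (x : ℝ) :
    ν (Iic (S x)) = m (Iic x) := by
  rw [← hmap, Measure.map_apply hS.measurable measurableSet_Iic]
  refine le_antisymm ?_ (measure_mono fun y hy => hS hy)
  have hsub : S ⁻¹' Iic (S x) ⊆ Iic x ∪ S ⁻¹' {S x} := fun y hy => by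
    rcases le_total y x with h | h
    · exact .inl h
    · exact .inr (le_antisymm hy (hS h))
  have h0 : m (S ⁻¹' {S x}) = 0 := by
    rw [← Measure.map_apply hS.measurable (measurableSet_singleton _), hmap]
    exact measure_singleton _
  calc m (S ⁻¹' Iic (S x)) ≤ m (Iic x) + m (S ⁻¹' {S x}) :=
        (measure_mono hsub).trans (measure_union_le _ _)
    _ = m (Iic x) := by rw [h0, add_zero]

lemma strictMono_of_map [IsFiniteMeasure m] (hS : Monotone S) (hmap : m.map S = ν)
    [NullSingletonClass ν] [m.IsOpenPosMeasure] : StrictMono S := by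
  refine hS.strictMono_of_injective fun x y hxy => (measure_Iic_strictMono m).injective ?_
  simp only [← measure_Iic_map hS hmap, hxy]

lemma ae_hasDerivAt_of_map [IsProbabilityMeasure m] {V : ℝ → ℝ} (hV : Continuous V)
    (hm : m = volume.withDensity (fun x => ENNReal.ofReal (Real.exp (-V x))))
    {A : Set ℝ} (hA : MeasurableSet A) (hA0 : 0 < m A) (hS : Monotone S)
    (hmap : m.map S = cond m A) :
    ∀ᵐ x, S x ∈ A ∧ ∃ s', 0 < s' ∧ HasDerivAt S s' x ∧
      s' * Real.exp (-V (S x)) = m.real A * Real.exp (-V x) := by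
  have hac := absolutelyContinuous_volume hm
  have hca := volume_absolutelyContinuous hV hm
  have : NullSingletonClass m := ⟨fun x => hac (measure_singleton x)⟩
  have : NullSingletonClass (cond m A) :=
    ⟨fun x => cond_absolutelyContinuous (measure_singleton x)⟩
  have hSm := hS.measurable
  have hApos : 0 < m.real A := ENNReal.toReal_pos hA0.ne' (measure_ne_top _ _)
  have hint : Integrable fun x => Real.exp (-V x) := by
    simpa using (integrable_iff_mul_exp hV hm fun _ => (1 : ℝ)).1 (integrable_const 1)
  -- A property that holds almost everywhere for the target measure holds at almost every `S x`.
  have pull : ∀ p : ℝ → Prop, (∀ᵐ y ∂(cond m A), p y) → ∀ᵐ x, p (S x) := fun p hp =>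
    hca.ae_le (ae_of_ae_map hSm.aemeasurable (hmap ▸ hp))
  have hmem := pull (· ∈ A) (ae_cond_mem hA)
  have hder := pull _ ((cond_absolutelyContinuous.trans hac).ae_le
    (ae_hasDerivAt_setIntegral_Iic (hint.indicator hA)))
  have hconj : ∀ x, (∫ t in Iic (S x), A.indicator (fun t => Real.exp (-V t)) t) =
      m.real A * ∫ t in Iic x, Real.exp (-V t) := fun x => by
    rw [setIntegral_indicator hA, ← real_eq_setIntegral hV hm (measurableSet_Iic.inter hA),
      ← real_eq_setIntegral hV hm measurableSet_Iic, measureReal_def m (Iic x),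
      ← measure_Iic_map hS hmap x, ← measureReal_def, inter_comm, measureReal_def m,
      measureReal_def m, measureReal_def (cond m A), ← ENNReal.toReal_mul,
      mul_comm, cond_mul_eq_inter hA]
  filter_upwards [hmem, hder, ae_hasDerivAt_setIntegral_Iic hint, hS.ae_differentiableAt]
    with x hxA hx1 hx2 hx3
  have h1 := hx1.comp x hx3.hasDerivAt
  have h2 := hx2.const_mul (m.real A)
  have heq : A.indicator (fun t => Real.exp (-V t)) (S x) * deriv S x =
      m.real A * Real.exp (-V x) := by
    refine h1.unique (h2.congr_of_eventuallyEq (.of_forall hconj))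
  rw [indicator_of_mem hxA, mul_comm] at heq
  refine ⟨hxA, deriv S x, ?_, hx3.hasDerivAt, heq⟩
  have : 0 < deriv S x * Real.exp (-V (S x)) := heq ▸ mul_pos hApos (Real.exp_pos _)
  exact pos_of_mul_pos_left this (Real.exp_pos _).le

end MongeAmpere

/-! ### The geometric mean of two monotone functions vanishing at the same point -/

/-- The signed geometric mean `h = ±√(f g)`, with the sign of `x - x₀`. -/
lemma exists_geomMean {f g : ℝ → ℝ} (hf : Monotone f) (hg : Monotone g) {x₀ : ℝ}
    (hf0 : f x₀ = 0) (hg0 : g x₀ = 0) :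
    ∃ h : ℝ → ℝ, Monotone h ∧ (∀ x, h x ^ 2 = f x * g x) ∧
      (∀ x, 0 ≤ (x - x₀) * (f x + g x - 2 * h x)) ∧ ∀ x, |h x| ≤ |f x| + |g x| := by
  have hfn : ∀ x, x ≤ x₀ → f x ≤ 0 := fun x hx => hf0 ▸ hf hx
  have hgn : ∀ x, x ≤ x₀ → g x ≤ 0 := fun x hx => hg0 ▸ hg hx
  have hfp : ∀ x, x₀ ≤ x → 0 ≤ f x := fun x hx => hf0 ▸ hf hx
  have hgp : ∀ x, x₀ ≤ x → 0 ≤ g x := fun x hx => hg0 ▸ hg hx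
  have hfg : ∀ x, 0 ≤ f x * g x := fun x => by
    rcases le_total x x₀ with h | h
    · exact mul_nonneg_of_nonpos_of_nonpos (hfn x h) (hgn x h)
    · exact mul_nonneg (hfp x h) (hgp x h)
  have hsq : ∀ x, √(f x * g x) ^ 2 = f x * g x := fun x => Real.sq_sqrt (hfg x)
  have hle : ∀ x, 2 * √(f x * g x) ≤ |f x + g x| := fun x => by
    refine (le_abs_self _).trans (sq_le_sq.1 ?_)
    nlinarith [sq_nonneg (f x - g x), hsq x]
  refine ⟨fun x => if x ≤ x₀ then -√(f x * g x) else √(f x * g x), ?_, ?_, ?_, ?_⟩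
  · intro x y hxy
    dsimp only
    split_ifs with h1 h2 h2
    · refine neg_le_neg (Real.sqrt_le_sqrt ?_)
      nlinarith [hf hxy, hg hxy, hfn y h2, hgn y h2, hfn x h1, hgn x h1]
    · exact (neg_nonpos.2 (Real.sqrt_nonneg _)).trans (Real.sqrt_nonneg _)
    · exact absurd (hxy.trans h2) h1
    · refine Real.sqrt_le_sqrt ?_
      have h1' := (not_le.1 h1).le
      have h2' := (not_le.1 h2).le
      exact mul_le_mul (hf hxy) (hg hxy) (hgp x h1') (hfp y h2')
  · intro x
    dsimp only
    split_ifs <;> simp [hsq x]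
  · intro x
    dsimp only
    split_ifs with h
    · refine mul_nonneg_of_nonpos_of_nonpos (by linarith) ?_
      have := hle x
      rw [abs_of_nonpos (by linarith [hfn x h, hgn x h])] at this
      linarith
    · have h' := (not_le.1 h).le
      refine mul_nonneg (by linarith) ?_
      have := hle x
      rw [abs_of_nonneg (by linarith [hfp x h', hgp x h'])] at this
      linarith
  · intro x
    have h1 : |if x ≤ x₀ then -√(f x * g x) else √(f x * g x)| = √(f x * g x) := by
      split_ifs <;> simp [abs_of_nonneg (Real.sqrt_nonneg _)]
    rw [h1]
    linarith [hle x, abs_add_le (f x) (g x), Real.sqrt_nonneg (f x * g x)]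

/-- Where they exist, the derivatives satisfy `(√(f g))' ≥ √(f' g')`. -/
lemma mul_le_sq_of_hasDerivAt {f g h : ℝ → ℝ} {f' g' h' x : ℝ} (hsq : ∀ y, h y ^ 2 = f y * g y)
    (hf : HasDerivAt f f' x) (hg : HasDerivAt g g' x) (hh : HasDerivAt h h' x)
    (hx : h x ≠ 0) : f' * g' ≤ h' ^ 2 := by
  have h1 := hh.pow 2
  have h2 := hf.mul hg
  have heq : (2 : ℝ) * h x * h' = f' * g x + f x * g' := by
    have := h1.unique (h2.congr_of_eventuallyEq (.of_forall hsq))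
    simpa using this
  have hpos : 0 < h x ^ 2 := by positivity
  refine le_of_mul_le_mul_left ?_ hpos
  nlinarith [sq_nonneg (f' * g x - f x * g'), hsq x, congrArg (· ^ 2) heq]

/-! ### One-sided integration by parts for monotone functions -/

lemma intervalIntegral_deriv_le {G : ℝ → ℝ} {K a b : ℝ} (hab : a ≤ b)
    (hG : MonotoneOn (fun x => G x + K * x) (Icc a b)) (hd : ∀ᵐ x, DifferentiableAt ℝ G x) :
    IntervalIntegrable (deriv G) volume a b ∧ ∫ x in a..b, deriv G x ≤ G b - G a := by
  rw [← uIcc_of_le hab] at hG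
  have hae : ∀ᵐ x, deriv G x = deriv (fun x => G x + K * x) x - K := by
    filter_upwards [hd] with x hx
    have := (hx.hasDerivAt.add ((hasDerivAt_id x).const_mul K)).deriv
    have e : deriv (fun x => G x + K * x) x = deriv G x + K * 1 := this
    rw [e]; ring
  have hi := hG.intervalIntegrable_deriv
  have hle := hG.intervalIntegral_deriv_mem_uIcc
  have hmono : G a + K * a ≤ G b + K * b := hG (by simp) (by simp) hab
  rw [uIcc_of_le (by simpa using hmono)] at hle
  have hi' : IntervalIntegrable (fun x => deriv (fun x => G x + K * x) x - K) volume a b :=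
    hi.sub intervalIntegrable_const
  refine ⟨hi'.congr_ae (ae_restrict_of_ae (hae.mono fun x hx => hx.symm)), ?_⟩
  rw [intervalIntegral.integral_congr_ae (hae.mono fun x hx _ => hx),
    intervalIntegral.integral_sub hi intervalIntegrable_const, intervalIntegral.integral_const]
  have := hle.2
  simp only [smul_eq_mul]
  linarith

/-- On a bounded interval, the product of a nonnegative `C¹` function with the difference of a
monotone function and a `C¹` function becomes monotone after adding a linear function. -/
lemma exists_monotoneOn_add_mul {h l φ : ℝ → ℝ} (hh : Monotone h) (hl : ContDiff ℝ 1 l)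
    (hφ : ContDiff ℝ 1 φ) (hφ0 : ∀ x, 0 ≤ φ x) (a b : ℝ) :
    ∃ K, MonotoneOn (fun x => (h x - l x) * φ x + K * x) (Icc a b) := by
  obtain ⟨L₁, hL₁⟩ := (hφ.locallyLipschitz.locallyLipschitzOn
    (s := Icc a b)).exists_lipschitzOnWith_of_compact isCompact_Icc
  obtain ⟨L₂, hL₂⟩ := ((hl.mul hφ).locallyLipschitz.locallyLipschitzOn
    (s := Icc a b)).exists_lipschitzOnWith_of_compact isCompact_Icc
  refine ⟨max |h a| |h b| * L₁ + L₂, fun x hx y hy hxy => ?_⟩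
  have hxy' := sub_nonneg.2 hxy
  have e1 := hL₁.dist_le_mul y hy x hx
  have e2 := hL₂.dist_le_mul y hy x hx
  rw [Real.dist_eq, Real.dist_eq, abs_of_nonneg hxy'] at e1 e2
  have hb : |h x| ≤ max |h a| |h b| := abs_le_max_abs_abs (hh hx.1) (hh hx.2)
  have e3 : |h x * (φ y - φ x)| ≤ max |h a| |h b| * (L₁ * (y - x)) := by
    rw [abs_mul]
    exact mul_le_mul hb e1 (abs_nonneg _) ((abs_nonneg _).trans hb)
  have e4 : 0 ≤ (h y - h x) * φ y := mul_nonneg (sub_nonneg.2 (hh hxy)) (hφ0 y)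
  have e5 := (abs_le.1 e3).1
  have e6 := (abs_le.1 e2).2
  dsimp only
  linarith

/-! ### The symmetrized transport inequality -/

/-- The pointwise inequality behind the theorem. Here `s`, `t` are the values of the transport maps
at `x`, with derivatives `s'`, `t'`; `h` is the geometric mean of `s - α` and `t - β`, with
derivative `h'`; and `v, v'` are the value and the derivative of the potential at `x`. -/
lemma pointwise_le {κ x s t h s' t' h' α β v v' vs vt a b : ℝ} (hκ : 0 < κ)
    (ha : 0 < a) (hb : 0 < b) (hs' : 0 < s') (ht' : 0 < t') (hh' : 0 ≤ h')
    (hvs : v + v' * (s - x) + κ / 2 * (s - x) ^ 2 ≤ vs)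
    (hvt : v + v' * (t - x) + κ / 2 * (t - x) ^ 2 ≤ vt)
    (hsq : h ^ 2 = (s - α) * (t - β))
    (hsign : 0 ≤ (v' - κ * x) * ((s - α) + (t - β) - 2 * h))
    (hs : s' * Real.exp (-vs) = a * Real.exp (-v)) (ht : t' * Real.exp (-vt) = b * Real.exp (-v))
    (hder : s' * t' ≤ h' ^ 2) :
    κ / 2 * (s - t) ^ 2 + κ * (β * s + α * t - α * β - (α + β) * x) +
      2 * (v' * (h - (x - (α + β) / 2)) - (h' - 1)) ≤ -Real.log (a * b) := by
  have ls := congrArg Real.log hs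
  have lt := congrArg Real.log ht
  rw [Real.log_mul hs'.ne' (Real.exp_pos _).ne', Real.log_mul ha.ne' (Real.exp_pos _).ne',
    Real.log_exp, Real.log_exp] at ls
  rw [Real.log_mul ht'.ne' (Real.exp_pos _).ne', Real.log_mul hb.ne' (Real.exp_pos _).ne',
    Real.log_exp, Real.log_exp] at lt
  have hpos : 0 < s' * t' := mul_pos hs' ht'
  have hh0 : 0 < h' := hh'.lt_of_ne fun h0 => by
    rw [← h0] at hder
    linarith
  have hlog : Real.log s' + Real.log t' ≤ 2 * (h' - 1) := by
    have h1 := Real.log_le_log hpos hder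
    rw [Real.log_mul hs'.ne' ht'.ne', Real.log_pow] at h1
    have h2 := Real.log_le_sub_one_of_pos hh0
    push_cast at h1
    linarith
  rw [Real.log_mul ha.ne' hb.ne']
  have hκh : 0 ≤ κ * (h - x) ^ 2 := by positivity
  have hsq' : κ * h ^ 2 = κ * ((s - α) * (t - β)) := by rw [hsq]
  linarith

/-- An integrable boundary term cannot keep a limit of truncated integrals away from `0`. -/
lemma nonneg_of_tendsto_of_integrable {I J : ℝ → ℝ} {L : ℝ}
    (hI : Filter.Tendsto I Filter.atTop (nhds L)) (hJ : Integrable J)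
    (hle : ∀ R, 0 ≤ R → -J R ≤ I R) : 0 ≤ L := by
  by_contra! hL
  obtain ⟨R₀, hR₀⟩ := Filter.eventually_atTop.1
    ((hI.eventually (gt_mem_nhds (show L < L / 2 by linarith))).and (Filter.eventually_ge_atTop 0))
  have hconst : IntegrableOn (fun _ => -L / 2) (Ioi R₀) := by
    refine hJ.integrableOn.mono' aestronglyMeasurable_const ?_
    refine (ae_restrict_mem measurableSet_Ioi).mono fun R hR => ?_
    obtain ⟨h1, h2⟩ := hR₀ R (le_of_lt hR)
    rw [Real.norm_eq_abs, abs_of_pos (by linarith)]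
    linarith [hle R h2]
  rw [integrableOn_const_iff] at hconst
  rcases hconst with h | h
  · rw [enorm_eq_zero] at h
    linarith
  · simp at h

lemma setDist_nonneg (A B : Set ℝ) : 0 ≤ setDist A B :=
  Real.sInf_nonneg (by rintro r ⟨a, -, b, -, rfl⟩; exact abs_nonneg _)

lemma setDist_le {A B : Set ℝ} {a b : ℝ} (ha : a ∈ A) (hb : b ∈ B) : setDist A B ≤ |a - b| :=
  csInf_le ⟨0, by rintro r ⟨a, -, b, -, rfl⟩; exact abs_nonneg _⟩ ⟨a, ha, b, hb, rfl⟩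

section Transport

variable {m : Measure ℝ} {A : Set ℝ} {S : ℝ → ℝ}

lemma integrable_of_map_cond (hid : Integrable (fun x => x) m) (hA0 : 0 < m A) (hS : Monotone S)
    (hmap : m.map S = cond m A) : Integrable S m := by
  have h : Integrable (fun x => x) (cond m A) :=
    hid.restrict.smul_measure (ENNReal.inv_ne_top.2 hA0.ne')
  rw [← hmap] at h
  exact (integrable_map_measure aestronglyMeasurable_id hS.measurable.aemeasurable).1 h

lemma integral_eq_baryOn (hS : Monotone S) (hmap : m.map S = cond m A) :
    ∫ x, S x ∂m = baryOn m A := by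
  rw [baryOn, bary, ← hmap, integral_map hS.measurable.aemeasurable
    (by fun_prop : Measurable fun x : ℝ => x).aestronglyMeasurable]

end Transport

/-- The concentration inequality for monotone transport maps, centred at any point `x₀` where
`V' x - κ x` changes sign. -/
theorem real_mul_real_le_exp {κ : ℝ} {V : ℝ → ℝ} {m : Measure ℝ} [IsProbabilityMeasure m]
    (hκ : 0 < κ) (hV : ContDiff ℝ 1 V)
    (htan : ∀ x y, V x + deriv V x * (y - x) + κ / 2 * (y - x) ^ 2 ≤ V y)
    (hm : m = volume.withDensity (fun x => ENNReal.ofReal (Real.exp (-V x))))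
    (hid : Integrable (fun x => x) m) {x₀ : ℝ}
    (hx₀ : ∀ x, 0 ≤ (deriv V x - κ * x) * (x - x₀)) {A B : Set ℝ} (hA : MeasurableSet A)
    (hB : MeasurableSet B) (hA0 : 0 < m A) (hB0 : 0 < m B) {S T : ℝ → ℝ} (hS : Monotone S)
    (hT : Monotone T) (hSm : m.map S = cond m A) (hTm : m.map T = cond m B) :
    m.real A * m.real B ≤
      Real.exp (-(κ / 2) * setDist A B ^ 2 + κ * Phi m A B (S x₀) (T x₀)) := by
  set α := S x₀
  set β := T x₀
  set d := setDist A B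
  have hVc := hV.continuous
  have hac := absolutelyContinuous_volume hm
  have hca := volume_absolutelyContinuous hVc hm
  have : m.IsOpenPosMeasure := hca.isOpenPosMeasure
  have : NullSingletonClass (cond m A) :=
    ⟨fun x => cond_absolutelyContinuous (hac (measure_singleton x))⟩
  have : NullSingletonClass (cond m B) :=
    ⟨fun x => cond_absolutelyContinuous (hac (measure_singleton x))⟩
  have hSs := strictMono_of_map hS hSm
  have hTs := strictMono_of_map hT hTm
  have ha : 0 < m.real A := ENNReal.toReal_pos hA0.ne' (measure_ne_top _ _)
  have hb : 0 < m.real B := ENNReal.toReal_pos hB0.ne' (measure_ne_top _ _)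
  have hSi := integrable_of_map_cond hid hA0 hS hSm
  have hTi := integrable_of_map_cond hid hB0 hT hTm
  obtain ⟨h, hh, hsq, hsign, habs⟩ := exists_geomMean (f := fun x => S x - α)
    (g := fun x => T x - β) (x₀ := x₀) (fun x y hxy => sub_le_sub_right (hS hxy) _)
    (fun x y hxy => sub_le_sub_right (hT hxy) _) (sub_self _) (sub_self _)
  have hhi : Integrable h m :=
    ((hSi.sub (integrable_const α)).abs.add (hTi.sub (integrable_const β)).abs).mono'
      hh.measurable.aestronglyMeasurable (.of_forall habs)
  let l : ℝ → ℝ := fun x => x - (α + β) / 2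
  have hl : ContDiff ℝ 1 l := by fun_prop
  have hφ : ContDiff ℝ 1 fun x => Real.exp (-V x) := by fun_prop
  let G : ℝ → ℝ := fun x => (h x - l x) * Real.exp (-V x)
  let u : ℝ → ℝ := fun x => -Real.log (m.real A * m.real B) - κ / 2 * d ^ 2 -
    κ * (β * S x + α * T x - α * β - (α + β) * x)
  have hi₁ : Integrable (fun x => β * S x + α * T x) m := (hSi.const_mul β).add (hTi.const_mul α)
  have hi₂ : Integrable (fun x => β * S x + α * T x - α * β) m := hi₁.sub (integrable_const _)
  have hi₃ : Integrable (fun x => (α + β) * x) m := hid.const_mul _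
  have hi₄ : Integrable (fun x => κ * (β * S x + α * T x - α * β - (α + β) * x)) m :=
    (hi₂.sub hi₃).const_mul κ
  have hui : Integrable u m := (integrable_const _).sub hi₄
  have hli : Integrable l m := hid.sub (integrable_const _)
  have hGi : Integrable G := (integrable_iff_mul_exp hVc hm _).1 (hhi.sub hli)
  have hu : ∫ x, u x ∂m =
      -Real.log (m.real A * m.real B) - κ / 2 * d ^ 2 + κ * Phi m A B α β := by
    have e : ∫ x, u x ∂m = (-Real.log (m.real A * m.real B) - κ / 2 * d ^ 2) -
        κ * (β * baryOn m A + α * baryOn m B - α * β - (α + β) * bary m) := by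
      simp only [u]
      rw [integral_sub (integrable_const _) hi₄, integral_const_mul, integral_sub hi₂ hi₃,
        integral_sub hi₁ (integrable_const _),
        integral_add (hSi.const_mul β) (hTi.const_mul α), integral_const_mul β,
        integral_const_mul α, integral_const_mul (α + β), integral_eq_baryOn hS hSm,
        integral_eq_baryOn hT hTm]
      simp [bary]
    rw [e, Phi]
    ring
  have hderiv : ∀ᵐ x, DifferentiableAt ℝ G x ∧ -2 * deriv G x ≤ u x * Real.exp (-V x) := by
    filter_upwards [ae_hasDerivAt_of_map hVc hm hA hA0 hS hSm,
      ae_hasDerivAt_of_map hVc hm hB hB0 hT hTm, hh.ae_differentiableAt,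
      Measure.ae_ne volume x₀] with x hxS hxT hxh hne
    obtain ⟨hxA, s', hs', hSd, hSe⟩ := hxS
    obtain ⟨hxB, t', ht', hTd, hTe⟩ := hxT
    have hh0 : h x ≠ 0 := fun h0 => by
      have := hsq x
      rw [h0, zero_pow two_ne_zero, eq_comm, mul_eq_zero, sub_eq_zero, sub_eq_zero] at this
      exact this.elim (fun e => hne (hSs.injective e)) fun e => hne (hTs.injective e)
    have hVd : HasDerivAt V (deriv V x) x :=
      (hV.differentiable one_ne_zero x).hasDerivAt
    have hGd : HasDerivAt G ((deriv h x - 1) * Real.exp (-V x) +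
        (h x - l x) * (Real.exp (-V x) * -deriv V x)) x :=
      (hxh.hasDerivAt.sub ((hasDerivAt_id x).sub_const _)).mul hVd.neg.exp
    refine ⟨hGd.differentiableAt, ?_⟩
    -- Both factors have the sign of `x - x₀`.
    have hsg : 0 ≤ (deriv V x - κ * x) * (S x - α + (T x - β) - 2 * h x) := by
      refine nonneg_of_mul_nonneg_left (b := (x - x₀) ^ 2) ?_ (by
        have := sub_ne_zero.2 hne
        positivity)
      linarith [mul_nonneg (hx₀ x) (hsign x)]
    have key := pointwise_le hκ ha hb hs' ht' hh.deriv_nonneg (htan x (S x)) (htan x (T x))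
      (hsq x) hsg hSe hTe
      (mul_le_sq_of_hasDerivAt hsq (hSd.sub_const α) (hTd.sub_const β) hxh.hasDerivAt hh0)
    have hd : d ^ 2 ≤ (S x - T x) ^ 2 := by
      rw [← sq_abs (S x - T x)]
      exact pow_le_pow_left₀ (setDist_nonneg A B) (setDist_le hxA hxB) 2
    have hd' := mul_le_mul_of_nonneg_left hd (half_pos hκ).le
    have hux : -2 * ((deriv h x - 1) - (h x - l x) * deriv V x) ≤ u x := by
      simp only [u, l]
      linarith
    have := mul_le_mul_of_nonneg_right hux (Real.exp_pos (-V x)).le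
    rw [hGd.deriv]
    linarith
  have huV := (integrable_iff_mul_exp hVc hm u).1 hui
  have hlim := intervalIntegral_tendsto_integral huV Filter.tendsto_neg_atTop_atBot
    Filter.tendsto_id
  rw [← integral_eq_mul_exp hVc hm, hu] at hlim
  have hfin := nonneg_of_tendsto_of_integrable hlim ((hGi.sub hGi.comp_neg).const_mul 2)
    fun R hR => by
      obtain ⟨K, hK⟩ := exists_monotoneOn_add_mul hh hl hφ (fun x => (Real.exp_pos _).le) (-R) R
      obtain ⟨hi, hle⟩ := intervalIntegral_deriv_le (G := G) (by linarith) hK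
        (hderiv.mono fun x hx => hx.1)
      have := intervalIntegral.integral_mono_ae (by linarith : -R ≤ R) (hi.const_mul (-2))
        huV.intervalIntegrable (hderiv.mono fun x hx => hx.2)
      rw [intervalIntegral.integral_const_mul] at this
      simp only [Pi.sub_apply, id]
      linarith
  rw [← Real.log_le_iff_le_exp (mul_pos ha hb)]
  linarith

/-! ### Strongly convex potentials -/

lemma _root_.ConvexOn.add_mul_sub_le {W : ℝ → ℝ} (hW : ConvexOn ℝ univ W) {x w' : ℝ}
    (hx : HasDerivAt W w' x) (y : ℝ) : W x + w' * (y - x) ≤ W y := by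
  rcases lt_trichotomy x y with h | rfl | h
  · have := hW.le_slope_of_hasDerivAt (mem_univ x) (mem_univ y) h hx
    rw [slope_def_field, le_div_iff₀ (sub_pos.2 h)] at this
    linarith
  · simp
  · have := hW.slope_le_of_hasDerivAt (mem_univ y) (mem_univ x) h hx
    rw [slope_def_field, div_le_iff₀ (sub_pos.2 h)] at this
    linarith

lemma _root_.StrongConvexOn.add_mul_sub_add_sq_le {κ : ℝ} {V : ℝ → ℝ}
    (hV : StrongConvexOn univ κ V) {x v' : ℝ} (hx : HasDerivAt V v' x) (y : ℝ) :
    V x + v' * (y - x) + κ / 2 * (y - x) ^ 2 ≤ V y := by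
  have hW := strongConvexOn_iff_convex.1 hV
  simp only [Real.norm_eq_abs, sq_abs] at hW
  have hd := hx.sub (((hasDerivAt_id x).pow 2).const_mul (κ / 2))
  have := hW.add_mul_sub_le hd y
  simp at this
  linarith

lemma integrable_id_of_sq_le {κ c : ℝ} (hκ : 0 < κ) {V : ℝ → ℝ} {m : Measure ℝ}
    (hV : Continuous V) (hVq : ∀ x, c + κ / 2 * x ^ 2 ≤ V x)
    (hm : m = volume.withDensity (fun x => ENNReal.ofReal (Real.exp (-V x)))) :
    Integrable (fun x => x) m := by
  rw [integrable_iff_mul_exp hV hm]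
  have hG : Integrable fun x : ℝ => Real.exp (-c) * (x * Real.exp (-(κ / 2) * x ^ 2)) :=
    (integrable_mul_exp_neg_mul_sq (half_pos hκ)).const_mul _
  refine hG.mono (by fun_prop : Continuous fun x => x * Real.exp (-V x)).aestronglyMeasurable
    (.of_forall fun x => ?_)
  simp only [norm_mul, Real.norm_eq_abs, Real.abs_exp]
  rw [mul_left_comm, ← Real.exp_add]
  refine mul_le_mul_of_nonneg_left (Real.exp_le_exp.2 ?_) (abs_nonneg x)
  linarith [hVq x]

lemma exists_map_of_density {V : ℝ → ℝ} {m : Measure ℝ} [IsProbabilityMeasure m]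
    (hV : Continuous V)
    (hm : m = volume.withDensity (fun x => ENNReal.ofReal (Real.exp (-V x))))
    {A : Set ℝ} (hA0 : 0 < m A) : ∃ S, IsOptimalTransportMap m (cond m A) S := by
  have := (volume_absolutelyContinuous hV hm).isOpenPosMeasure
  have : NullSingletonClass m := ⟨fun x => absolutelyContinuous_volume hm (measure_singleton x)⟩
  have := cond_isProbabilityMeasure hA0.ne'
  exact exists_isOptimalTransportMap m (cond m A)

/-! ### The Gaussian measure -/

/-- The potential of the standard Gaussian measure. -/
noncomputable def gaussianPotential (x : ℝ) : ℝ := x ^ 2 / 2 + Real.log √(2 * Real.pi)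

lemma contDiff_gaussianPotential : ContDiff ℝ 1 gaussianPotential := by
  unfold gaussianPotential
  fun_prop

lemma deriv_gaussianPotential (x : ℝ) : deriv gaussianPotential x = x := by
  have : HasDerivAt gaussianPotential (2 * x / 2) x := by
    unfold gaussianPotential
    simpa using (((hasDerivAt_id x).pow 2).div_const 2).add_const (Real.log √(2 * Real.pi))
  rw [this.deriv]
  ring

lemma gaussianReal_eq_withDensity : gaussianReal 0 1 =
    volume.withDensity (fun x => ENNReal.ofReal (Real.exp (-gaussianPotential x))) := by
  rw [gaussianReal_of_var_ne_zero _ one_ne_zero]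
  congr 1
  ext x
  rw [gaussianPDF, gaussianPDFReal, gaussianPotential, neg_add, Real.exp_add,
    Real.exp_neg (Real.log _), Real.exp_log (by positivity)]
  simp [mul_comm, neg_div]

lemma integrable_id_gaussianReal : Integrable (fun x => x) (gaussianReal 0 1) :=
  integrable_id_of_sq_le (c := Real.log √(2 * Real.pi)) one_pos
    contDiff_gaussianPotential.continuous (fun x => by rw [gaussianPotential]; linarith)
    gaussianReal_eq_withDensity

/-- For the Gaussian measure every point can serve as the centre. -/
lemma gaussianReal_mul_le_exp {A B : Set ℝ} (hA : MeasurableSet A)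
    (hB : MeasurableSet B) (hA0 : 0 < gaussianReal 0 1 A) (hB0 : 0 < gaussianReal 0 1 B)
    {S T : ℝ → ℝ} (hS : Monotone S) (hT : Monotone T)
    (hSm : (gaussianReal 0 1).map S = cond (gaussianReal 0 1) A)
    (hTm : (gaussianReal 0 1).map T = cond (gaussianReal 0 1) B) (x₀ : ℝ) :
    (gaussianReal 0 1).real A * (gaussianReal 0 1).real B ≤
      Real.exp (-(1 / 2) * setDist A B ^ 2 + Phi (gaussianReal 0 1) A B (S x₀) (T x₀)) := by
  have := real_mul_real_le_exp one_pos contDiff_gaussianPotential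
    (fun x y => by
      rw [deriv_gaussianPotential, gaussianPotential, gaussianPotential]
      exact le_of_eq (by ring))
    gaussianReal_eq_withDensity integrable_id_gaussianReal (x₀ := x₀)
    (fun x => by simp [deriv_gaussianPotential]) hA hB hA0 hB0 hS hT hSm hTm
  rwa [one_mul] at this

/-- A monotone function crosses its mean at some point; there its value may be replaced by the mean
without destroying monotonicity. -/
lemma exists_monotone_update {m : Measure ℝ} [IsProbabilityMeasure m] {S : ℝ → ℝ}
    (hS : Monotone S) (hSi : Integrable S m) :
    ∃ x₀, Monotone (Function.update S x₀ (∫ x, S x ∂m)) := by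
  set c := ∫ x, S x ∂m
  obtain ⟨x₁, hx₁⟩ : ∃ x, S x ≤ c := exists_le_integral hSi
  obtain ⟨x₂, hx₂⟩ : ∃ x, c ≤ S x := exists_integral_le hSi
  by_cases hbdd : BddAbove {x | S x ≤ c}
  · refine ⟨sSup {x | S x ≤ c}, fun x y hxy => ?_⟩
    have hlow : ∀ y < sSup {x | S x ≤ c}, S y ≤ c := fun y hy => by
      obtain ⟨p, hp, hyp⟩ := exists_lt_of_lt_csSup ⟨x₁, hx₁⟩ hy
      exact (hS hyp.le).trans hp
    have hhigh : ∀ y, sSup {x | S x ≤ c} < y → c ≤ S y := fun y hy => by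
      by_contra! hlt
      exact hy.not_ge (le_csSup hbdd hlt.le)
    rw [Function.update_apply, Function.update_apply]
    split_ifs with h1 h2 h2
    · exact le_rfl
    · exact hhigh y ((h1 ▸ hxy).lt_of_ne (Ne.symm h2))
    · exact hlow x ((h2 ▸ hxy).lt_of_ne h1)
    · exact hS hxy
  · refine ⟨x₂, ?_⟩
    obtain ⟨y, hy, hxy⟩ := not_bddAbove_iff.1 hbdd x₂
    have : c = S x₂ := le_antisymm hx₂ ((hS hxy.le).trans hy)
    rwa [this, Function.update_eq_self]

end Conc

open Conc in
theorem theorem6p1 :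
    (∀ (κ : ℝ) (V : ℝ → ℝ) (m : Measure ℝ), 0 < κ → ContDiff ℝ ∞ V → StrongConvexOn univ κ V →
      m = volume.withDensity (fun x => ENNReal.ofReal (Real.exp (-V x))) →
      IsProbabilityMeasure m → (∀ x, V 0 ≤ V x) →
      ∀ A B : Set ℝ, MeasurableSet A → MeasurableSet B → 0 < m A → 0 < m B →
        (∃ S, Conc.IsOptimalTransportMap m (cond m A) S) ∧
        (∃ T, Conc.IsOptimalTransportMap m (cond m B) T) ∧
        ∀ S T : ℝ → ℝ, Conc.IsOptimalTransportMap m (cond m A) S →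
          Conc.IsOptimalTransportMap m (cond m B) T →
          m.real A * m.real B ≤
            Real.exp (-(κ / 2) * Conc.setDist A B ^ 2 + κ * Conc.Phi m A B (S 0) (T 0))) ∧
    (∀ A B : Set ℝ, MeasurableSet A → MeasurableSet B →
      0 < gaussianReal 0 1 A → 0 < gaussianReal 0 1 B →
        (∃ S, Conc.IsOptimalTransportMap (gaussianReal 0 1) (cond (gaussianReal 0 1) A) S) ∧
        (∃ T, Conc.IsOptimalTransportMap (gaussianReal 0 1) (cond (gaussianReal 0 1) B) T) ∧
        ∀ S T : ℝ → ℝ,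
          Conc.IsOptimalTransportMap (gaussianReal 0 1) (cond (gaussianReal 0 1) A) S →
          Conc.IsOptimalTransportMap (gaussianReal 0 1) (cond (gaussianReal 0 1) B) T →
          Conc.Phi (gaussianReal 0 1) A B (S 0) (T 0) =
            -T 0 * Conc.baryOn (gaussianReal 0 1) A - S 0 * Conc.baryOn (gaussianReal 0 1) B
              + S 0 * T 0 ∧
          (gaussianReal 0 1).real A * (gaussianReal 0 1).real B ≤
            Real.exp (-(1 / 2) * Conc.setDist A B ^ 2 +
              min (Conc.Phi (gaussianReal 0 1) A B (S 0) (T 0))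
                (-(Conc.baryOn (gaussianReal 0 1) A * Conc.baryOn (gaussianReal 0 1) B)))) := by
  refine ⟨fun κ V m hκ hVs hVκ hm _ hmin A B hA hB hA0 hB0 => ?_, fun A B hA hB hA0 hB0 => ?_⟩
  · have hV : ContDiff ℝ 1 V := hVs.of_le (by exact_mod_cast le_top)
    have hVd : ∀ x, HasDerivAt V (deriv V x) x := fun x =>
      (hV.differentiable one_ne_zero x).hasDerivAt
    have htan : ∀ x y, V x + deriv V x * (y - x) + κ / 2 * (y - x) ^ 2 ≤ V y := fun x y =>
      hVκ.add_mul_sub_add_sq_le (hVd x) y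
    have hd0 : deriv V 0 = 0 := IsLocalMin.deriv_eq_zero (.of_forall hmin)
    have hquad : ∀ x, V 0 + κ / 2 * x ^ 2 ≤ V x := fun x => by
      have := htan 0 x
      rw [hd0] at this
      linarith
    have hid := integrable_id_of_sq_le hκ hV.continuous hquad hm
    refine ⟨exists_map_of_density hV.continuous hm hA0, exists_map_of_density hV.continuous hm hB0,
      fun S T hS hT => real_mul_real_le_exp hκ hV htan hm hid (x₀ := 0) (fun x => ?_) hA hB hA0 hB0
        hS.monotone hT.monotone hS.map_eq hT.map_eq⟩
    linarith [htan x 0, hquad x]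
  · have hV := contDiff_gaussianPotential.continuous
    have hm := gaussianReal_eq_withDensity
    refine ⟨exists_map_of_density hV hm hA0, exists_map_of_density hV hm hB0, fun S T hS hT => ?_⟩
    have hbary : bary (gaussianReal 0 1) = 0 := integral_id_gaussianReal
    have hPhi : ∀ a b, Phi (gaussianReal 0 1) A B a b =
        -b * baryOn (gaussianReal 0 1) A - a * baryOn (gaussianReal 0 1) B + a * b := fun a b => by
      rw [Phi, hbary, mul_zero, add_zero]
    refine ⟨hPhi _ _, ?_⟩
    rw [← min_add_add_left, Real.exp_monotone.map_min]
    refine le_min (gaussianReal_mul_le_exp hA hB hA0 hB0 hS.monotone hT.monotone hS.map_eq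
      hT.map_eq 0) ?_
    -- Centre at a point where `S` crosses its mean: then `Φ` reduces to minus the product of the
    -- barycenters, whatever the value of `T` there.
    obtain ⟨x₀, hx₀⟩ := exists_monotone_update hS.monotone
      (integrable_of_map_cond integrable_id_gaussianReal hA0 hS.monotone hS.map_eq)
    rw [integral_eq_baryOn hS.monotone hS.map_eq] at hx₀
    have hae : Function.update S x₀ (baryOn (gaussianReal 0 1) A) =ᵐ[gaussianReal 0 1] S := by
      filter_upwards [(absolutelyContinuous_volume hm).ae_le (Measure.ae_ne volume x₀)] with x hx
      exact Function.update_of_ne hx _ _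
    have := gaussianReal_mul_le_exp hA hB hA0 hB0 hx₀ hT.monotone
      ((Measure.map_congr hae).trans hS.map_eq) hT.map_eq x₀
    rw [Function.update_self, hPhi] at this
    refine this.trans_eq (congrArg Real.exp ?_)
    ring
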